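/- Let $T$ be an essentially small triangulated category with a bounded t-structure $(T^{\le 0},T^{\ge 0})$, i.e. $T=\bigcup_{i,j\in\mathbb Z}T^{\le i}\cap T^{\ge j}$, and let $A=T^{\le 0}\cap T^{\ge 0}$ be its heart (an abelian category). Let $K_0(A)$ (resp. $K_0(T)$) be the free abelian group on isomorphism classes of objects modulo $[X]-[Y]+[Z]$ for all short exact sequences $0\to X\to Y\to Z\to 0$ in $A$ (resp. all exact triangles $X\to Y\to Z\to X[1]$ in $T$). Let $G$ be a family of objects of $A$ which is a generator or a cogenerator of $A$: every $M\in A$ fits in a short exact sequence $0\to M'\to N\to M\to 0$ with $N\in G$, or every $M\in A$ fits in a short exact sequence $0\to M\to N\to M'\to 0$ with $N\in G$. All subcategories are full, additive and closed under isomorphism; a subcategory is *dense* if every object of the ambient category is a direct summand of one of its objects. A subcategory of $A$ is *$G$-resolving* (resp. *$G$-coresolving*) if it contains $G$ and is closed under extensions and under kernels of epimorphisms (resp. cokernels of monomorphisms). Then the inclusion $A\hookrightarrow T$ induces an isomorphism $K_0(A)\cong K_0(T)$; the dense $G$-resolving and the dense $G$-coresolving subcategories of $A$ coincide; and there are one-to-one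 correspondences among the following sets: 1. dense $G$-resolving (equivalently, dense $G$-coresolving) subcategories of $A$; 2. dense triangulated subcategories of $T$ containing $G$; 3. subgroups of $K_0(T)$ containing the image of $G$. Explicitly, the correspondence between (1) and (3) is $\mathcal X\mapsto\langle [X]\mid X\in\mathcal X\rangle\subseteq K_0(T)$ with inverse $H\mapsto\{M\in A\mid [M]\in H\}$; the one between (2) and (3) is $\mathcal Y\mapsto\langle [Y]\mid Y\in\mathcal Y\rangle$ with inverse $H\mapsto\{X\in T\mid [X]\in H\}$; and $\mathcal Y\mapsto\mathcal Y\cap A$ is a bijection from (2) to (1). -/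

import Mathlib

open CategoryTheory CategoryTheory.Limits CategoryTheory.Triangulated
  CategoryTheory.Pretriangulated

universe w v u

noncomputable section

namespace DenseSubcat

section Classes

variable (C : Type u) [Category.{v} C]

/-- The free abelian group on the isomorphism classes of objects of `C`. -/
abbrev FreeOnIsoClasses : Type u :=
  FreeAbelianGroup (Quotient (isIsomorphicSetoid C))

variable {C}

/-- The generator attached to the isomorphism class of `X`. -/
def gen (X : C) : FreeOnIsoClasses C :=
  FreeAbelianGroup.of (Quotient.mk (isIsomorphicSetoid C) X)

end Classes

section Exact

variable (C : Type u) [Category.{v} C] [HasZeroMorphisms C]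

/-- The Grothendieck group of an abelian category `C`: isomorphism classes of objects modulo
`[A] - [B] + [A']` for every short exact sequence `0 ⟶ A ⟶ B ⟶ A' ⟶ 0`. (Only the zero morphisms
of `C` enter the definition of short exact sequences.) -/
abbrev KZeroExact : Type u :=
  FreeOnIsoClasses C ⧸ AddSubgroup.closure
    {z : FreeOnIsoClasses C | ∃ S : ShortComplex C, S.ShortExact ∧
      z = gen S.X₁ - gen S.X₂ + gen S.X₃}

variable {C}

/-- The class of an object in the Grothendieck group of an abelian category. -/
def clsExact (X : C) : KZeroExact C := QuotientAddGroup.mk (gen X)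

/-- `P` is a full additive subcategory (closed under isomorphisms). -/
structure IsAdditiveSubcat (P : ObjectProperty C) : Prop where
  iso_closed : P.IsClosedUnderIsomorphisms
  zero : P.ContainsZero
  sum : ∀ ⦃A B : C⦄ (b : BinaryBicone A B), Nonempty b.IsBilimit → P A → P B → P b.pt

/-- `P` is dense: every object is a direct summand of an object of `P`, i.e. for every `A`
there are `A'` and a direct sum `A ⊕ A'` lying in `P`. -/
def IsDenseSubcat (P : ObjectProperty C) : Prop :=
  ∀ A : C, ∃ (A' : C) (b : BinaryBicone A A'), Nonempty b.IsBilimit ∧ P b.pt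

/-- `G` is a generator: every object `A` sits in a short exact sequence
`0 ⟶ A' ⟶ G₀ ⟶ A ⟶ 0` with `G₀` in `G`. -/
def IsGeneratorFamily (G : ObjectProperty C) : Prop :=
  ∀ A : C, ∃ (A' G₀ : C) (i : A' ⟶ G₀) (p : G₀ ⟶ A) (h : i ≫ p = 0),
    (ShortComplex.mk i p h).ShortExact ∧ G G₀

/-- `G` is a cogenerator: every object `A` sits in a short exact sequence
`0 ⟶ A ⟶ G₀ ⟶ A' ⟶ 0` with `G₀` in `G`. -/
def IsCogeneratorFamily (G : ObjectProperty C) : Prop :=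
  ∀ A : C, ∃ (G₀ A' : C) (i : A ⟶ G₀) (p : G₀ ⟶ A') (h : i ≫ p = 0),
    (ShortComplex.mk i p h).ShortExact ∧ G G₀

/-- `P` is a `G`-resolving subcategory. -/
structure IsResolving (G P : ObjectProperty C) : Prop where
  additive : IsAdditiveSubcat P
  ext_closed : ∀ S : ShortComplex C, S.ShortExact → P S.X₁ → P S.X₃ → P S.X₂
  ker_closed : ∀ S : ShortComplex C, S.ShortExact → P S.X₂ → P S.X₃ → P S.X₁
  contains : G ≤ P

/-- `P` is a `G`-coresolving subcategory. -/
structure IsCoresolving (G P : ObjectProperty C) : Prop where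
  additive : IsAdditiveSubcat P
  ext_closed : ∀ S : ShortComplex C, S.ShortExact → P S.X₁ → P S.X₃ → P S.X₂
  coker_closed : ∀ S : ShortComplex C, S.ShortExact → P S.X₁ → P S.X₂ → P S.X₃
  contains : G ≤ P

/-- The set of dense `G`-resolving subcategories. -/
def denseResolving (G : ObjectProperty C) : Set (ObjectProperty C) :=
  {P | IsResolving G P ∧ IsDenseSubcat P}

/-- The set of dense `G`-coresolving subcategories. -/
def denseCoresolving (G : ObjectProperty C) : Set (ObjectProperty C) :=
  {P | IsCoresolving G P ∧ IsDenseSubcat P}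

end Exact

section Triang

variable (T : Type u) [Category.{v} T] [Preadditive T] [HasZeroObject T] [HasShift T ℤ]
  [∀ n : ℤ, (shiftFunctor T n).Additive] [Pretriangulated T]

/-- The Grothendieck group of a triangulated category: isomorphism classes of objects modulo
`[X] - [Y] + [Z]` for every distinguished triangle `X ⟶ Y ⟶ Z ⟶ X⟦1⟧`. -/
abbrev KZeroTri : Type u :=
  FreeOnIsoClasses T ⧸ AddSubgroup.closure
    {z : FreeOnIsoClasses T | ∃ D : Triangle T, D ∈ distTriang T ∧
      z = gen D.obj₁ - gen D.obj₂ + gen D.obj₃}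

variable {T}

/-- The class of an object in the Grothendieck group of a triangulated category. -/
def clsTri (X : T) : KZeroTri T := QuotientAddGroup.mk (gen X)

variable (t : TStructure T)

/-- The heart of a t-structure, as a full subcategory. -/
abbrev HeartCat : Type u := t.heart.FullSubcategory

variable {t}

/-- The set of dense triangulated subcategories of `T` (full, closed under isomorphisms)
containing a family `G` of objects of the heart. -/
def denseTriangulated (G : ObjectProperty (HeartCat t)) : Set (ObjectProperty T) :=
  {Q | Q.IsTriangulated ∧ Q.IsClosedUnderIsomorphisms ∧ IsDenseSubcat Q ∧
    ∀ A : HeartCat t, G A → Q A.obj}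

/-- The set of subgroups of the Grothendieck group of `T` containing the image of `G`. -/
def subgroupsContaining (G : ObjectProperty (HeartCat t)) : Set (AddSubgroup (KZeroTri T)) :=
  {H | ∀ A : HeartCat t, G A → clsTri A.obj ∈ H}

/-- The subgroup generated by the classes of the objects of a subcategory of the heart. -/
def heartToSubgroup (P : ObjectProperty (HeartCat t)) : AddSubgroup (KZeroTri T) :=
  AddSubgroup.closure {x | ∃ A : HeartCat t, P A ∧ x = clsTri A.obj}

/-- The objects of the heart whose class lies in a given subgroup. -/
def subgroupToHeart (t : TStructure T) (H : AddSubgroup (KZeroTri T)) :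
    ObjectProperty (HeartCat t) :=
  fun A => clsTri A.obj ∈ H

/-- The subgroup generated by the classes of the objects of a subcategory of `T`. -/
def triToSubgroup (Q : ObjectProperty T) : AddSubgroup (KZeroTri T) :=
  AddSubgroup.closure {x | ∃ X : T, Q X ∧ x = clsTri X}

/-- The objects of `T` whose class lies in a given subgroup. -/
def subgroupToTri (H : AddSubgroup (KZeroTri T)) : ObjectProperty T :=
  fun X => clsTri X ∈ H

end Triang

end DenseSubcat

end

/-!
The theorem combines an isomorphism of Grothendieck groups with a stabilization argument.

*The isomorphism `K₀(A) ≅ K₀(T)`.* The heart `A` is abelian: the kernel and the cokernel of a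
morphism are read off the truncations of its cone (`heartAbelian`), and short exact sequences of
`A` are distinguished triangles of `T`, so the inclusion induces `K₀(A) ⟶ K₀(T)`. It is surjective
because a bounded object is built by truncations from shifts of objects of the heart
(`clsTri_mem_of_heart`). A left inverse is the Euler characteristic `X ↦ ∑ (-1)ⁿ [Hⁿ X]`. Its
additivity on triangles comes from the long exact cohomology sequence (`euler_distTriang`), that
is, from the fact that `H⁰` is a homological functor (`H0_isHomological`).

*Subcategories and subgroups.* Let `P` be dense, additive and closed under extensions. Isomorphism
classes of objects modulo stable isomorphism (`X ⊞ P₁ ≅ Y ⊞ P₂` with `P₁`, `P₂` in `P`) form a group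
(`exists_stable_class`): density provides the negatives. An extension `Y` of `Z` by `X` satisfies
`[Y] = [X] + [Z]` there, since complements `X'` and `Z'` with `X ⊞ X'` and `Z ⊞ Z'` in `P` give
`Y ⊞ (X' ⊞ Z')` in `P` (`additive_of_complement`). This group is therefore a quotient of `K₀` in
which `P` vanishes, and an object whose class is generated by classes of objects of `P` satisfies
`X ⊞ A ∈ P` for some `A ∈ P`. Each of the three closure conditions (kernels of epimorphisms,
cokernels of monomorphisms, cones) then gives `X ∈ P`; hence `P` is recovered from its subgroup, see
`prop_of_clsExact_mem` and `prop_of_clsTri_mem`.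

Conversely the objects with class in a subgroup `H` satisfy all closure conditions. In `T` they are
dense because `[X ⊞ X⟦1⟧] = 0`. In the heart density uses `G`: each `A` has an `A'` such that
`[A] + [A'] = [N]` with `N` in `G` (`exists_complement_class`). The conditions for `G`-resolving and
`G`-coresolving subcategories thus both single out the subcategories `{M | [M] ∈ H}`.
-/

namespace DenseSubcat

noncomputable section

/-! ### The heart of a t-structure is abelian -/

section Triangles

variable {T : Type u} [Category.{v} T] [Preadditive T] [HasZeroObject T] [HasShift T ℤ]
  [∀ n : ℤ, (shiftFunctor T n).Additive] [Pretriangulated T]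

lemma distTriang_of_iso₁ {X X' Y Z : T} {f : X ⟶ Y} {g : Y ⟶ Z} {h : Z ⟶ X⟦(1 : ℤ)⟧}
    (hT : Triangle.mk f g h ∈ distTriang T) (e : X' ≅ X) :
    Triangle.mk (e.hom ≫ f) g (h ≫ e.inv⟦(1 : ℤ)⟧') ∈ distTriang T :=
  have h₃ : (h ≫ e.inv⟦(1 : ℤ)⟧') ≫ e.hom⟦(1 : ℤ)⟧' = h := by
    rw [Category.assoc, ← Functor.map_comp, e.inv_hom_id, CategoryTheory.Functor.map_id,
      Category.comp_id]
  isomorphic_distinguished _ hT _ (Triangle.isoMk _ _ e (Iso.refl _) (Iso.refl _)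
    (Category.comp_id _) ((Category.comp_id _).trans (Category.id_comp _).symm)
    (h₃.trans (Category.id_comp _).symm))

lemma isLE_of_distTriang (t : TStructure T) {X Y Z : T} {f : X ⟶ Y} {g : Y ⟶ Z}
    {h : Z ⟶ X⟦(1 : ℤ)⟧} (hT : Triangle.mk f g h ∈ distTriang T) (n : ℤ)
    [hX : t.IsLE X n] [hZ : t.IsLE Z n] : t.IsLE Y n :=
  t.isLE₂ _ hT n hX hZ

lemma isGE_of_distTriang (t : TStructure T) {X Y Z : T} {f : X ⟶ Y} {g : Y ⟶ Z}
    {h : Z ⟶ X⟦(1 : ℤ)⟧} (hT : Triangle.mk f g h ∈ distTriang T) (n : ℤ)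
    [hX : t.IsGE X n] [hZ : t.IsGE Z n] : t.IsGE Y n :=
  t.isGE₂ _ hT n hX hZ

lemma distTriang_rotate {X Y Z : T} {f : X ⟶ Y} {g : Y ⟶ Z}
    {h : Z ⟶ X⟦(1 : ℤ)⟧} (hT : Triangle.mk f g h ∈ distTriang T) :
    Triangle.mk g h (-f⟦(1 : ℤ)⟧') ∈ distTriang T :=
  rot_of_distTriang _ hT

/-- The truncation triangle `τ_{<n} X ⟶ X ⟶ τ_{≥n} X ⟶ (τ_{<n} X)⟦1⟧`. -/
lemma distTriang_trunc (t : TStructure T) (n : ℤ) (X : T) :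
    Triangle.mk ((t.truncLTι n).app X) ((t.truncGEπ n).app X) ((t.truncGEδLT n).app X) ∈
      distTriang T :=
  t.triangleLTGE_distinguished n X

end Triangles

section Heart

variable {T : Type u} [Category.{v} T] [Preadditive T] [HasZeroObject T] [HasShift T ℤ]
  [∀ n : ℤ, (shiftFunctor T n).Additive] [Pretriangulated T]

instance heart_isLE {t : TStructure T} (A : HeartCat t) : t.IsLE A.obj 0 :=
  ((t.mem_heart_iff _).1 A.property).1

instance heart_isGE {t : TStructure T} (A : HeartCat t) : t.IsGE A.obj 0 :=
  ((t.mem_heart_iff _).1 A.property).2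

instance heart_isLE_ι {t : TStructure T} (A : HeartCat t) : t.IsLE (t.heart.ι.obj A) 0 :=
  heart_isLE A

instance heart_isGE_ι {t : TStructure T} (A : HeartCat t) : t.IsGE (t.heart.ι.obj A) 0 :=
  heart_isGE A

variable (t : TStructure T)

instance heart_containsZero : t.heart.ContainsZero where
  exists_zero := ⟨_, isZero_zero T, (t.mem_heart_iff _).2 ⟨inferInstance, inferInstance⟩⟩

lemma heart_biprod {X Y : T} (hX : t.heart X) (hY : t.heart Y) : t.heart (X ⊞ Y) := by
  rw [TStructure.mem_heart_iff] at *
  exact ⟨t.isLE₂ _ (binaryBiproductTriangle_distinguished X Y) 0 hX.1 hY.1,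
    t.isGE₂ _ (binaryBiproductTriangle_distinguished X Y) 0 hX.2 hY.2⟩

instance heart_closedUnderBinaryProducts : t.heart.IsClosedUnderBinaryProducts where
  limitsOfShape_le := by
    rintro X ⟨p⟩
    exact t.heart.prop_of_iso
      (biprod.isoProd _ _ ≪≫ HasLimit.isoOfNatIso (diagramIsoPair p.diag).symm ≪≫
        (limit.isLimit _).conePointUniqueUpToIso p.isLimit)
      (heart_biprod t (p.prop_diag_obj ⟨.left⟩) (p.prop_diag_obj ⟨.right⟩))

instance heart_hasFiniteProducts : HasFiniteProducts (HeartCat t) := by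
  have := ObjectProperty.IsClosedUnderFiniteProducts.mk' (P := t.heart)
  infer_instance

/-- There are no nonzero morphisms of negative degree between objects of the heart. -/
lemma heart_hom_eq_zero ⦃X Y : HeartCat t⦄ ⦃n : ℤ⦄
    (f : t.heart.ι.obj X ⟶ (t.heart.ι.obj Y)⟦n⟧) (hn : n < 0) : f = 0 :=
  t.zero_of_isLE_of_isGE f 0 (-n) (by lia) inferInstance
    (t.isGE_shift (t.heart.ι.obj Y) 0 n (-n))

/-- In the cone of a morphism of the heart, the two truncations at `0` are, up to a shift,
objects of the heart: they are the kernel and the cokernel of the morphism. -/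
lemma heart_admissible [IsTriangulated T] :
    AbelianSubcategory.admissibleMorphism t.heart.ι = ⊤ := by
  ext X₁ X₂ f
  simp only [MorphismProperty.top_apply, iff_true]
  intro X₃ f₂ f₃ hT
  have := t.isLE_shift (t.heart.ι.obj X₁) 0 1 (-1)
  have := t.isLE_of_le ((t.heart.ι.obj X₁)⟦(1 : ℤ)⟧) (-1) 0
  have := t.isGE_shift (t.heart.ι.obj X₁) 0 1 (-1)
  have := t.isGE_of_ge (t.heart.ι.obj X₂) (-1) 0
  have : t.IsLE X₃ 0 := isLE_of_distTriang t (distTriang_rotate hT) 0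
  have : t.IsGE X₃ (-1) := isGE_of_distTriang t (distTriang_rotate hT) (-1)
  have := t.isLE_truncLT_obj X₃ 0 (-1)
  have := t.isLE_shift ((t.truncLT 0).obj X₃) (-1) (-1) 0
  have := t.isGE_shift ((t.truncLT 0).obj X₃) (-1) (-1) 0
  let K : HeartCat t := ⟨((t.truncLT 0).obj X₃)⟦(-1 : ℤ)⟧,
    (t.mem_heart_iff _).2 ⟨inferInstance, inferInstance⟩⟩
  let Q : HeartCat t := ⟨(t.truncGE 0).obj X₃,
    (t.mem_heart_iff _).2 ⟨inferInstance, inferInstance⟩⟩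
  let e : (t.heart.ι.obj K)⟦(1 : ℤ)⟧ ≅ (t.truncLT 0).obj X₃ :=
    (shiftEquiv T (1 : ℤ)).counitIso.app ((t.truncLT 0).obj X₃)
  exact ⟨K, Q, _, _, _, distTriang_of_iso₁ (distTriang_trunc t 0 X₃) e⟩

/-- The heart of a t-structure is an abelian category. -/
instance heartAbelian [IsTriangulated T] : Abelian (HeartCat t) :=
  AbelianSubcategory.abelian t.heart.ι (heart_hom_eq_zero t) (heart_admissible t)

end Heart

/-! ### The zeroth cohomology functor is homological -/

section Homology

variable {T : Type u} [Category.{v} T] [Preadditive T] [HasZeroObject T] [HasShift T ℤ]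
  [∀ n : ℤ, (shiftFunctor T n).Additive] [Pretriangulated T]

/-- A morphism `P ⟶ N` with `P ≤ 0` and `N < 0` can be killed by precomposing with some
`P' ⟶ P` that is still an epimorphism on zeroth cohomology: morphisms from `P` to objects `≥ 0`
are detected on `P'`. -/
lemma exists_refinement_comp_eq_zero (t : TStructure T) {P N : T} (u : P ⟶ N)
    [t.IsLE P 0] [t.IsLE N (-1)] :
    ∃ (P' : T) (p : P' ⟶ P), t.IsLE P' 0 ∧ p ≫ u = 0 ∧
      ∀ ⦃B : T⦄ (_ : t.IsGE B 0) (f : P ⟶ B), p ≫ f = 0 → f = 0 := by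
  obtain ⟨P', p, h, hT⟩ := distinguished_cocone_triangle₁ u
  have hN : t.IsLE (N⟦(-1 : ℤ)⟧) 0 := t.isLE_shift N (-1) (-1) 0
  refine ⟨P', p, t.isLE₂ _ (inv_rot_of_distTriang _ hT) 0 hN ‹_›,
    comp_distTriang_mor_zero₁₂ _ hT, fun B _ f hf ↦ ?_⟩
  obtain ⟨g, hg⟩ : ∃ g : N ⟶ B, f = u ≫ g := Triangle.yoneda_exact₂ _ hT f hf
  rw [hg, t.zero g (-1) 0, comp_zero]

variable [IsTriangulated T]

/-- The zeroth cohomology functor of a t-structure, with values in the heart. -/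
def H0 (t : TStructure T) : T ⥤ HeartCat t :=
  t.heart.lift (t.truncGELT 0 1) (fun X ↦ (t.mem_heart_iff _).2
    ⟨(inferInstance : t.IsLE ((t.truncGELT 0 1).obj X) (1 - 1)), inferInstance⟩)

instance H0_preservesZeroMorphisms (t : TStructure T) : (H0 t).PreservesZeroMorphisms where
  map_zero X Y := ObjectProperty.hom_ext _ ((t.truncGELT 0 1).map_zero X Y)

/-- Exactness is checked on generalized elements `A ⟶ H⁰ Y` up to refinement. After refining
`A` to an object `P ≤ 0` of the triangulated category, such an element lifts to `P ⟶ Y`; after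
a second refinement the lift is killed in `Z`, and so comes from `X`. -/
instance H0_isHomological (t : TStructure T) : (H0 t).IsHomological where
  exact := by
    rintro ⟨X, Y, Z, f, g, h⟩ hT
    rw [ShortComplex.exact_iff_exact_up_to_refinements]
    rintro A x hx
    let WX := (t.truncLT 1).obj X
    let WY := (t.truncLT 1).obj Y
    let WZ := (t.truncLT 1).obj Z
    let x' : A.obj ⟶ (t.truncGE 0).obj WY := x.hom
    have hx' : x' ≫ (t.truncGE 0).map ((t.truncLT 1).map g) = 0 :=
      congrArg InducedCategory.Hom.hom hx
    have := t.isLE_truncLT_obj WY 0 (-1)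
    have := t.isLE_shift ((t.truncLT 0).obj WY) (-1) 1 (-2)
    have := t.isLE_of_le (((t.truncLT 0).obj WY)⟦(1 : ℤ)⟧) (-2) (-1)
    let δ : (t.truncGE 0).obj WY ⟶ ((t.truncLT 0).obj WY)⟦(1 : ℤ)⟧ := (t.truncGEδLT 0).app WY
    -- The obstruction to lifting `x` along `τ_{<1} Y ⟶ H⁰ Y` lies in `(τ_{<0} Y)⟦1⟧`, so it can
    -- be killed by a refinement.
    obtain ⟨P, a, _, ha, ha'⟩ := exists_refinement_comp_eq_zero t (x' ≫ δ)
    obtain ⟨w, hw⟩ : ∃ w : P ⟶ WY, a ≫ x' = w ≫ (t.truncGEπ 0).app WY :=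
      Triangle.coyoneda_exact₃ _ (distTriang_trunc t 0 WY) (a ≫ x')
        ((Category.assoc _ _ _).trans ha)
    have hwg : (w ≫ (t.truncLT 1).map g) ≫ (t.truncGEπ 0).app WZ = 0 := by
      have := (t.truncGEπ 0).naturality ((t.truncLT 1).map g)
      dsimp only [Functor.id_map] at this
      rw [Category.assoc, this, ← Category.assoc, ← hw, Category.assoc, hx', comp_zero]
    obtain ⟨n, hn⟩ : ∃ n : P ⟶ (t.truncLT 0).obj WZ,
        w ≫ (t.truncLT 1).map g = n ≫ (t.truncLTι 0).app WZ :=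
      Triangle.coyoneda_exact₂ _ (distTriang_trunc t 0 WZ) _ hwg
    -- The image of the lift in `τ_{<1} Z` vanishes in `H⁰ Z`, so it comes from `τ_{<0} Z`, and it
    -- is killed by a second refinement.
    have := t.isLE_truncLT_obj WZ 0 (-1)
    obtain ⟨P', p, _, hp, hp'⟩ := exists_refinement_comp_eq_zero t n
    have hnat := (t.truncLTι 1).naturality g
    dsimp only [Functor.id_map] at hnat
    have hz : (p ≫ w ≫ (t.truncLTι 1).app Y) ≫ g = 0 := by
      rw [Category.assoc, Category.assoc, ← hnat, ← Category.assoc w, hn, Category.assoc,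
        ← Category.assoc p, hp, zero_comp]
    obtain ⟨y, hy⟩ : ∃ y : P' ⟶ X, p ≫ w ≫ (t.truncLTι 1).app Y = y ≫ f :=
      Triangle.coyoneda_exact₂ _ hT _ hz
    let y' : P' ⟶ WX := t.liftTruncLT y 0 1 rfl
    have hy' : y' ≫ (t.truncLT 1).map f = p ≫ w := by
      have : t.IsLE P' (1 - 1) := ‹_›
      apply t.to_truncLT_obj_ext
      rw [Category.assoc, (t.truncLTι 1).naturality f, ← Category.assoc, t.liftTruncLT_ι y 0 1 rfl]
      exact hy.symm.trans (Category.assoc _ _ _).symm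
    let A' : HeartCat t := ⟨(t.truncGE 0).obj P', (t.mem_heart_iff _).2
      ⟨inferInstance, inferInstance⟩⟩
    let π' : (t.truncGE 0).obj P' ⟶ A.obj := t.descTruncGE (p ≫ a) 0
    have hπ' : (t.truncGEπ 0).app P' ≫ π' = p ≫ a := t.π_descTruncGE _ _
    let π : A' ⟶ A := ObjectProperty.homMk π'
    have hπ : Epi π := by
      rw [Preadditive.epi_iff_cancel_zero]
      intro B b hb
      have hb' : π' ≫ b.hom = 0 := congrArg InducedCategory.Hom.hom hb
      refine ObjectProperty.hom_ext _ (ha' inferInstance b.hom (hp' inferInstance _ ?_))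
      rw [← Category.assoc, ← hπ', Category.assoc, hb', comp_zero]
    refine ⟨A', π, hπ, ObjectProperty.homMk ((t.truncGE 0).map y'), ObjectProperty.hom_ext _ ?_⟩
    change π' ≫ x' = (t.truncGE 0).map y' ≫ (t.truncGE 0).map ((t.truncLT 1).map f)
    have : t.IsGE ((t.truncGE 0).obj WY) 0 := inferInstance
    apply t.from_truncGE_obj_ext
    rw [← Category.assoc, hπ', Category.assoc, hw, ← Functor.map_comp, hy',
      ← (t.truncGEπ 0).naturality (p ≫ w)]
    exact (Category.assoc _ _ _).symm

omit [IsTriangulated T] in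
lemma isZero_heart_of_isZero_obj {t : TStructure T} {A : HeartCat t} (hA : IsZero A.obj) :
    IsZero A := by
  rw [IsZero.iff_id_eq_zero] at hA ⊢
  exact ObjectProperty.hom_ext _ hA

lemma isZero_H0_of_isGE (t : TStructure T) (X : T) [t.IsGE X 1] : IsZero ((H0 t).obj X) :=
  isZero_heart_of_isZero_obj ((t.truncGE 0).map_isZero (t.isZero_truncLT_obj_of_isGE 1 X))

lemma isZero_H0_of_isLE (t : TStructure T) (X : T) [t.IsLE X (-1)] : IsZero ((H0 t).obj X) :=
  isZero_heart_of_isZero_obj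
    (t.isZero_truncGE_obj_of_isLE (-1) 0 (by lia) ((t.truncLT 1).obj X))

/-- The zeroth cohomology of an object of the heart is the object itself. -/
def H0Iso (t : TStructure T) (A : HeartCat t) : (H0 t).obj A.obj ≅ A :=
  haveI : IsIso ((t.truncLTι 1).app A.obj) :=
    (t.isLE_iff_isIso_truncLTι_app 0 1 (by lia) A.obj).1 inferInstance
  haveI : IsIso ((t.truncGEπ 0).app ((t.truncLT 1).obj A.obj)) :=
    (t.isGE_iff_isIso_truncGEπ_app 0 _).1 inferInstance
  t.heart.isoMk ((asIso ((t.truncGEπ 0).app ((t.truncLT 1).obj A.obj))).symm ≪≫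
    asIso ((t.truncLTι 1).app A.obj))

end Homology

/-! ### The Euler characteristic -/

section ExactClasses

lemma gen_eq_of_iso {C : Type u} [Category.{v} C] {X Y : C} (e : X ≅ Y) : gen X = gen Y :=
  congrArg FreeAbelianGroup.of (Quotient.sound ⟨e⟩)

variable {C : Type u} [Category.{v} C]

lemma clsExact_eq_of_iso [HasZeroMorphisms C] {X Y : C} (e : X ≅ Y) : clsExact X = clsExact Y :=
  congrArg QuotientAddGroup.mk (gen_eq_of_iso e)

lemma clsExact_of_shortExact [HasZeroMorphisms C] {S : ShortComplex C} (hS : S.ShortExact) :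
    clsExact S.X₂ = clsExact S.X₁ + clsExact S.X₃ := by
  have h : clsExact S.X₁ - clsExact S.X₂ + clsExact S.X₃ = 0 :=
    (QuotientAddGroup.eq_zero_iff (gen S.X₁ - gen S.X₂ + gen S.X₃)).2
      (AddSubgroup.subset_closure ⟨S, hS, rfl⟩)
  rw [sub_add_eq_add_sub] at h
  exact (sub_eq_zero.1 h).symm

variable [Abelian C]

lemma clsExact_biprod (X Y : C) : clsExact (X ⊞ Y) = clsExact X + clsExact Y :=
  clsExact_of_shortExact (ShortComplex.Splitting.ofHasBinaryBiproduct X Y).shortExact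

lemma clsExact_of_isZero {X : C} (hX : IsZero X) : clsExact X = 0 := by
  have := (clsExact_biprod X X).symm.trans (clsExact_eq_of_iso
    ((biprod.mapIso (hX.iso (isZero_zero C)) (Iso.refl X)) ≪≫ (isoZeroBiprod (isZero_zero C)).symm))
  simpa using this

lemma clsExact_eq_image_add_image {S : ShortComplex C} (hS : S.Exact) :
    clsExact S.X₂ = clsExact (Abelian.image S.f) + clsExact (Abelian.image S.g) := by
  have hf : Abelian.factorThruImage S.f ≫ Abelian.image.ι S.f = S.f := Abelian.image.fac S.f
  have hg : Abelian.factorThruImage S.g ≫ Abelian.image.ι S.g = S.g := Abelian.image.fac S.g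
  have h₁ : Abelian.image.ι S.f ≫ S.g = 0 := by
    rw [← cancel_epi (Abelian.factorThruImage S.f), ← Category.assoc, hf, S.zero, comp_zero]
  have h₂ : Abelian.image.ι S.f ≫ Abelian.factorThruImage S.g = 0 := by
    rw [← cancel_mono (Abelian.image.ι S.g), Category.assoc, hg, h₁, zero_comp]
  let S₁ : ShortComplex C := .mk (Abelian.image.ι S.f) S.g h₁
  let S₂ : ShortComplex C := .mk (Abelian.image.ι S.f) (Abelian.factorThruImage S.g) h₂
  let φ₁ : S ⟶ S₁ := ⟨Abelian.factorThruImage S.f, 𝟙 _, 𝟙 _,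
    hf.trans (Category.comp_id _).symm, (Category.id_comp _).trans (Category.comp_id _).symm⟩
  let φ₂ : S₂ ⟶ S₁ := ⟨𝟙 _, 𝟙 _, Abelian.image.ι S.g,
    (Category.id_comp _).trans (Category.comp_id _).symm, (Category.id_comp _).trans hg.symm⟩
  have : Epi φ₁.τ₁ := inferInstanceAs (Epi (Abelian.factorThruImage S.f))
  have : IsIso φ₁.τ₂ := inferInstanceAs (IsIso (𝟙 _))
  have : Mono φ₁.τ₃ := inferInstanceAs (Mono (𝟙 _))
  have : Epi φ₂.τ₁ := inferInstanceAs (Epi (𝟙 _))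
  have : IsIso φ₂.τ₂ := inferInstanceAs (IsIso (𝟙 _))
  have : Mono φ₂.τ₃ := inferInstanceAs (Mono (Abelian.image.ι S.g))
  have hS₂ : S₂.Exact := (ShortComplex.exact_iff_of_epi_of_isIso_of_mono φ₂).2
    ((ShortComplex.exact_iff_of_epi_of_isIso_of_mono φ₁).1 hS)
  have : Mono S₂.f := inferInstanceAs (Mono (Abelian.image.ι S.f))
  have : Epi S₂.g := inferInstanceAs (Epi (Abelian.factorThruImage S.g))
  exact clsExact_of_shortExact ⟨hS₂⟩

end ExactClasses

section Euler

variable {T : Type u} [Category.{v} T] [Preadditive T] [HasZeroObject T] [HasShift T ℤ]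
  [∀ n : ℤ, (shiftFunctor T n).Additive] [Pretriangulated T] [IsTriangulated T]

/-- The class of the `n`-th cohomology object of `X` in the Grothendieck group of the heart. -/
def clsH (t : TStructure T) (X : T) (n : ℤ) : KZeroExact (HeartCat t) :=
  clsExact ((H0 t).obj (X⟦n⟧))

/-- The Euler characteristic `∑ (-1)ⁿ [Hⁿ X]` of an object of `T`. The sum is finite for
bounded `X`. -/
def euler (t : TStructure T) (X : T) : KZeroExact (HeartCat t) :=
  ∑ᶠ n : ℤ, (n.negOnePow : ℤ) • clsH t X n

lemma isZero_H0_shift (t : TStructure T) (X : T) (a b n : ℤ) [t.IsGE X a] [t.IsLE X b]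
    (hn : n ∉ Set.Icc a b) : IsZero ((H0 t).obj (X⟦n⟧)) := by
  rw [Set.mem_Icc, not_and_or, not_le, not_le] at hn
  rcases hn with hn | hn
  · have := t.isGE_shift X a n (a - n)
    have := t.isGE_of_ge (X⟦n⟧) 1 (a - n)
    exact isZero_H0_of_isGE t _
  · have := t.isLE_shift X b n (b - n)
    have := t.isLE_of_le (X⟦n⟧) (b - n) (-1)
    exact isZero_H0_of_isLE t _

lemma clsH_support_subset (t : TStructure T) (X : T) (a b : ℤ) [t.IsGE X a] [t.IsLE X b] :
    Function.support (fun n : ℤ ↦ (n.negOnePow : ℤ) • clsH t X n) ⊆ Set.Icc a b := by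
  intro n hn
  by_contra h
  exact hn (by simp only [clsH, clsExact_of_isZero (isZero_H0_shift t X a b n h), smul_zero])

lemma clsH_support_finite (t : TStructure T) {X : T} (hX : t.bounded X) :
    (Function.support (fun n : ℤ ↦ (n.negOnePow : ℤ) • clsH t X n)).Finite := by
  obtain ⟨⟨a, _⟩, ⟨b, _⟩⟩ := hX
  exact (Set.finite_Icc a b).subset (clsH_support_subset t X a b)

/-- In the long exact cohomology sequence of a triangle, the alternating sum of the three classes
in degree `n` is the sum of the classes `d (n - 1)` and `d n` of the images of the two adjacent
connecting maps. -/
lemma exists_clsH_eq (t : TStructure T) (D : Triangle T) (hD : D ∈ distTriang T) :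
    ∃ d : ℤ → KZeroExact (HeartCat t),
      (∀ n, IsZero ((H0 t).obj (D.obj₃⟦n⟧)) → d n = 0) ∧
      ∀ n, clsH t D.obj₁ n - clsH t D.obj₂ n + clsH t D.obj₃ n = d (n - 1) + d n := by
  let _ : (H0 t).ShiftSequence ℤ := Functor.ShiftSequence.tautological (H0 t) ℤ
  let d (n : ℤ) : KZeroExact (HeartCat t) :=
    clsExact (Abelian.image ((H0 t).homologySequenceδ D n (n + 1) rfl))
  have hd (n₀ n₁ : ℤ) (h : n₀ + 1 = n₁) :
      clsExact (Abelian.image ((H0 t).homologySequenceδ D n₀ n₁ h)) = d n₀ := by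
    subst h; rfl
  refine ⟨d, fun n hn ↦ ?_, fun n ↦ ?_⟩
  · have hn' : IsZero (((H0 t).shift n).obj D.obj₃) := hn
    exact clsExact_of_isZero (hn'.of_epi
      (Abelian.factorThruImage ((H0 t).homologySequenceδ D n (n + 1) rfl)))
  · have h₁ := clsExact_eq_image_add_image
      ((H0 t).homologySequence_exact₁ D hD (n - 1) n (by lia))
    have h₂ := clsExact_eq_image_add_image ((H0 t).homologySequence_exact₂ D hD n)
    have h₃ := clsExact_eq_image_add_image ((H0 t).homologySequence_exact₃ D hD n (n + 1) rfl)
    dsimp only at h₁ h₂ h₃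
    rw [hd] at h₁ h₃
    change clsH t D.obj₁ n = _ at h₁
    change clsH t D.obj₂ n = _ at h₂
    change clsH t D.obj₃ n = _ at h₃
    rw [h₁, h₂, h₃]
    abel

/-- The Euler characteristic is additive: multiplied by the signs, the contributions of the
connecting maps telescope. -/
lemma euler_distTriang (t : TStructure T) (ht : ∀ X : T, t.bounded X) (D : Triangle T)
    (hD : D ∈ distTriang T) : euler t D.obj₁ - euler t D.obj₂ + euler t D.obj₃ = 0 := by
  obtain ⟨d, hd₀, hd⟩ := exists_clsH_eq t D hD
  let f (n : ℤ) : KZeroExact (HeartCat t) := (n.negOnePow : ℤ) • d n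
  have hf : f.support.Finite := by
    obtain ⟨⟨a, _⟩, ⟨b, _⟩⟩ := ht D.obj₃
    refine (Set.finite_Icc a b).subset fun n hn ↦ ?_
    by_contra h
    exact hn (by simp only [f, hd₀ n (isZero_H0_shift t D.obj₃ a b n h), smul_zero])
  have hf' : (Function.support fun n ↦ f (n - 1)).Finite :=
    hf.preimage (sub_left_injective.injOn)
  have hs (n : ℤ) : (n.negOnePow : ℤ) • clsH t D.obj₁ n - (n.negOnePow : ℤ) • clsH t D.obj₂ n +
      (n.negOnePow : ℤ) • clsH t D.obj₃ n = f n - f (n - 1) := by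
    rw [← smul_sub, ← smul_add, hd, smul_add, sub_eq_add_neg (f n), add_comm (f n)]
    simp only [f, Int.negOnePow_sub, Int.negOnePow_one]
    simp
  have h₁ := clsH_support_finite t (ht D.obj₁)
  have h₂ := clsH_support_finite t (ht D.obj₂)
  have h₃ := clsH_support_finite t (ht D.obj₃)
  rw [euler, euler, euler, ← finsum_sub_distrib h₁ h₂, ← finsum_add_distrib ?_ h₃]
  · simp only [hs]
    rw [finsum_sub_distrib hf hf', sub_eq_zero]
    exact (finsum_comp_equiv (Equiv.subRight (1 : ℤ)) (f := f)).symm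
  · exact (h₁.union h₂).subset (Function.support_sub _ _)

lemma euler_heart (t : TStructure T) (A : HeartCat t) : euler t A.obj = clsExact A := by
  have h := clsH_support_subset t A.obj 0 0
  rw [euler, finsum_eq_single _ (0 : ℤ)]
  · have e : (H0 t).obj (A.obj⟦(0 : ℤ)⟧) ≅ A :=
      (H0 t).mapIso ((shiftFunctorZero T ℤ).app A.obj) ≪≫ H0Iso t A
    simpa [clsH] using clsExact_eq_of_iso e
  · intro n hn
    by_contra h'
    have := h h'
    rw [Set.Icc_self] at this
    exact hn this

end Euler

/-! ### Comparison of the Grothendieck groups -/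

section Lift

variable {C : Type u} [Category.{v} C]

/-- The homomorphism out of the free group on isomorphism classes induced by a function on
objects which is invariant under isomorphism. -/
def liftGen {M : Type*} [AddCommGroup M] (f : C → M)
    (hf : ∀ ⦃X Y : C⦄, (X ≅ Y) → f X = f Y) : FreeOnIsoClasses C →+ M :=
  FreeAbelianGroup.lift (Quotient.lift f (fun _ _ ⟨e⟩ ↦ hf e))

@[simp]
lemma liftGen_gen {M : Type*} [AddCommGroup M] (f : C → M)
    (hf : ∀ ⦃X Y : C⦄, (X ≅ Y) → f X = f Y) (X : C) : liftGen f hf (gen X) = f X :=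
  FreeAbelianGroup.lift_apply_of _ _

lemma closure_range_gen : AddSubgroup.closure (Set.range (gen (C := C))) = ⊤ := by
  rw [eq_top_iff]
  rintro z -
  induction z using FreeAbelianGroup.induction_on with
  | zero => exact zero_mem _
  | of x =>
    obtain ⟨X, rfl⟩ := Quotient.exists_rep x
    exact AddSubgroup.subset_closure ⟨X, rfl⟩
  | neg x hx => exact neg_mem hx
  | add x y hx hy => exact add_mem hx hy

/-- The universal property of the Grothendieck group of an abelian category. -/
lemma exists_lift_clsExact [HasZeroMorphisms C] {M : Type*} [AddCommGroup M] (f : C → M)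
    (hf : ∀ ⦃X Y : C⦄, (X ≅ Y) → f X = f Y)
    (h : ∀ S : ShortComplex C, S.ShortExact → f S.X₁ - f S.X₂ + f S.X₃ = 0) :
    ∃ φ : KZeroExact C →+ M, ∀ X, φ (clsExact X) = f X := by
  refine ⟨QuotientAddGroup.lift _ (liftGen f hf) ?_, fun X ↦ liftGen_gen f hf X⟩
  rw [AddSubgroup.closure_le]
  rintro _ ⟨S, hS, rfl⟩
  simpa using h S hS

lemma closure_range_clsExact [HasZeroMorphisms C] :
    AddSubgroup.closure (Set.range (clsExact (C := C))) = ⊤ := by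
  have := congrArg (AddSubgroup.map (QuotientAddGroup.mk' (AddSubgroup.closure
    {z : FreeOnIsoClasses C | ∃ S : ShortComplex C, S.ShortExact ∧
      z = gen S.X₁ - gen S.X₂ + gen S.X₃}))) (closure_range_gen (C := C))
  rw [AddMonoidHom.map_closure, ← Set.range_comp, ← AddMonoidHom.range_eq_map,
    AddMonoidHom.range_eq_top_of_surjective _ (QuotientAddGroup.mk'_surjective _)] at this
  exact this

end Lift

section TriClasses

variable {T : Type u} [Category.{v} T] [Preadditive T] [HasZeroObject T] [HasShift T ℤ]
  [∀ n : ℤ, (shiftFunctor T n).Additive] [Pretriangulated T]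

/-- The universal property of the Grothendieck group of a triangulated category. -/
lemma exists_lift_clsTri {M : Type*} [AddCommGroup M] (f : T → M)
    (hf : ∀ ⦃X Y : T⦄, (X ≅ Y) → f X = f Y)
    (h : ∀ D : Triangle T, D ∈ distTriang T → f D.obj₁ - f D.obj₂ + f D.obj₃ = 0) :
    ∃ φ : KZeroTri T →+ M, ∀ X, φ (clsTri X) = f X := by
  refine ⟨QuotientAddGroup.lift _ (liftGen f hf) ?_, fun X ↦ liftGen_gen f hf X⟩
  rw [AddSubgroup.closure_le]
  rintro _ ⟨D, hD, rfl⟩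
  simpa using h D hD

lemma closure_range_clsTri : AddSubgroup.closure (Set.range (clsTri (T := T))) = ⊤ := by
  have := congrArg (AddSubgroup.map (QuotientAddGroup.mk' (AddSubgroup.closure
    {z : FreeOnIsoClasses T | ∃ D : Triangle T, D ∈ distTriang T ∧
      z = gen D.obj₁ - gen D.obj₂ + gen D.obj₃}))) (closure_range_gen (C := T))
  rw [AddMonoidHom.map_closure, ← Set.range_comp, ← AddMonoidHom.range_eq_map,
    AddMonoidHom.range_eq_top_of_surjective _ (QuotientAddGroup.mk'_surjective _)] at this
  exact this

lemma clsTri_eq_of_iso {X Y : T} (e : X ≅ Y) : clsTri X = clsTri Y :=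
  congrArg QuotientAddGroup.mk (gen_eq_of_iso e)

lemma clsTri_of_distTriang (D : Triangle T) (hD : D ∈ distTriang T) :
    clsTri D.obj₂ = clsTri D.obj₁ + clsTri D.obj₃ := by
  have h : clsTri D.obj₁ - clsTri D.obj₂ + clsTri D.obj₃ = 0 :=
    (QuotientAddGroup.eq_zero_iff (gen D.obj₁ - gen D.obj₂ + gen D.obj₃)).2
      (AddSubgroup.subset_closure ⟨D, hD, rfl⟩)
  rw [sub_add_eq_add_sub] at h
  exact (sub_eq_zero.1 h).symm

lemma clsTri_biprod (X Y : T) : clsTri (X ⊞ Y) = clsTri X + clsTri Y :=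
  clsTri_of_distTriang _ (binaryBiproductTriangle_distinguished X Y)

lemma clsTri_of_isZero {X : T} (hX : IsZero X) : clsTri X = 0 := by
  have := (clsTri_biprod X X).symm.trans (clsTri_eq_of_iso
    ((biprod.mapIso (hX.iso (isZero_zero T)) (Iso.refl X)) ≪≫ (isoZeroBiprod (isZero_zero T)).symm))
  simpa using this

open scoped ZeroObject in
lemma clsTri_shift_one (X : T) : clsTri (X⟦(1 : ℤ)⟧) = -clsTri X := by
  have h := clsTri_of_distTriang _ (rot_of_distTriang _ (contractible_distinguished X))
  change clsTri (0 : T) = clsTri X + clsTri (X⟦(1 : ℤ)⟧) at h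
  rw [clsTri_of_isZero (isZero_zero T)] at h
  exact (neg_eq_of_add_eq_zero_right h.symm).symm

lemma clsTri_shift (X : T) (n : ℤ) : clsTri (X⟦n⟧) = (n.negOnePow : ℤ) • clsTri X := by
  have h (m : ℤ) : clsTri (X⟦m + 1⟧) = -clsTri (X⟦m⟧) :=
    (clsTri_eq_of_iso ((shiftFunctorAdd T m 1).app X)).trans (clsTri_shift_one _)
  induction n using Int.induction_on with
  | zero => simpa using clsTri_eq_of_iso ((shiftFunctorZero T ℤ).app X)
  | succ i hi => rw [h, hi, Int.negOnePow_succ]; simp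
  | pred i hi =>
    have := h (-i - 1)
    rw [sub_add_cancel, hi] at this
    rw [← neg_eq_iff_eq_neg.2 this, Int.negOnePow_sub, Int.negOnePow_one]
    simp

variable {t : TStructure T}

/-- When the t-structure is bounded, the classes of the objects of the heart generate the
Grothendieck group of `T`: an object is built from shifts of objects of the heart by truncations. -/
lemma clsTri_mem_of_heart [IsTriangulated T] (ht : ∀ X : T, t.bounded X)
    (H : AddSubgroup (KZeroTri T))
    (hH : ∀ A : HeartCat t, clsTri A.obj ∈ H) (X : T) : clsTri X ∈ H := by
  have key (n : ℕ) : ∀ (X : T) (a : ℤ), t.IsGE X a → t.IsLE X (a + n) → clsTri X ∈ H := by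
    induction n with
    | zero =>
      intro X a _ hX
      rw [Nat.cast_zero, add_zero] at hX
      have h := hH ⟨X⟦a⟧, (t.mem_heart_iff _).2
        ⟨t.isLE_shift X a a 0, t.isGE_shift X a a 0⟩⟩
      have h' := H.zsmul_mem h (a.negOnePow : ℤ)
      rwa [clsTri_shift, smul_smul, ← Units.val_mul, Int.units_mul_self, Units.val_one,
        one_smul] at h'
    | succ n ih =>
      intro X a _ hX
      have : t.IsLE X (a + 1 + n) := by
        have e : a + ((n + 1 : ℕ) : ℤ) = a + 1 + n := by push_cast; ring
        rwa [e] at hX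
      have h := clsTri_of_distTriang _ (distTriang_trunc t (a + 1) X)
      change clsTri X = clsTri ((t.truncLT (a + 1)).obj X) + clsTri ((t.truncGE (a + 1)).obj X) at h
      rw [h]
      refine add_mem (ih _ a inferInstance ?_) (ih _ (a + 1) inferInstance inferInstance)
      exact t.isLE_of_le _ a (a + n)
  obtain ⟨⟨a, ha⟩, ⟨b, hb⟩⟩ := ht X
  exact key (b - a).toNat X a ha (t.isLE_of_le X b _)

/-- A short exact sequence of the heart completes to a distinguished triangle of `T`, so its
relation holds in the Grothendieck group of `T`. -/
lemma clsTri_of_shortExact [IsTriangulated T] {S : ShortComplex (HeartCat t)} (hS : S.ShortExact) :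
    clsTri S.X₂.obj = clsTri S.X₁.obj + clsTri S.X₃.obj := by
  have := hS.epi_g
  obtain ⟨K, i, δ, hT⟩ := AbelianSubcategory.exists_distinguished_triangle_of_epi
    (heart_hom_eq_zero t) (heart_admissible t) S.g
  have hK := AbelianSubcategory.isLimitKernelForkOfDistTriang (heart_hom_eq_zero t) i S.g δ hT
  let e : K.obj ≅ S.X₁.obj := t.heart.ι.mapIso (hK.conePointUniqueUpToIso hS.fIsKernel)
  have h := clsTri_of_distTriang _ hT
  change clsTri S.X₂.obj = clsTri K.obj + clsTri S.X₃.obj at h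
  rw [h, clsTri_eq_of_iso e]

/-- The inclusion of the heart of a bounded t-structure induces an isomorphism of Grothendieck
groups. The inverse is the Euler characteristic. -/
lemma exists_addEquiv_KZero [IsTriangulated T] (ht : ∀ X : T, t.bounded X) :
    ∃ φ : KZeroExact (HeartCat t) ≃+ KZeroTri T, ∀ A : HeartCat t,
      φ (clsExact A) = clsTri A.obj := by
  obtain ⟨φ, hφ⟩ := exists_lift_clsExact (fun A : HeartCat t ↦ clsTri A.obj)
    (fun _ _ e ↦ clsTri_eq_of_iso (t.heart.ι.mapIso e))
    (fun S hS ↦ by rw [clsTri_of_shortExact hS]; abel)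
  obtain ⟨ψ, hψ⟩ := exists_lift_clsTri (euler t)
    (fun X Y e ↦ finsum_congr fun n ↦ congrArg _
      (clsExact_eq_of_iso ((shiftFunctor T n ⋙ H0 t).mapIso e)))
    (euler_distTriang t ht)
  have hl : Function.LeftInverse ψ φ := by
    have : (ψ.comp φ) = AddMonoidHom.id _ := by
      refine AddMonoidHom.eq_of_eqOn_dense closure_range_clsExact ?_
      rintro _ ⟨A, rfl⟩
      exact (congrArg ψ (hφ A)).trans ((hψ _).trans (euler_heart t A))
    exact DFunLike.congr_fun this
  have hs : Function.Surjective φ := by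
    rw [← AddMonoidHom.range_eq_top, eq_top_iff, ← closure_range_clsTri, AddSubgroup.closure_le]
    rintro _ ⟨X, rfl⟩
    exact clsTri_mem_of_heart ht φ.range (fun A ↦ ⟨_, hφ A⟩) X
  exact ⟨AddEquiv.ofBijective φ ⟨hl.injective, hs⟩, hφ⟩

end TriClasses

/-! ### Stable classes modulo a dense subcategory -/

section Stable

/-- The congruence on a commutative monoid which identifies two elements that become equal
after adding elements of a submonoid. -/
def stableCon {M : Type*} [AddCommMonoid M] (N : AddSubmonoid M) : AddCon M where
  r a b := ∃ m ∈ N, ∃ n ∈ N, a + m = b + n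
  iseqv :=
    { refl a := ⟨0, N.zero_mem, 0, N.zero_mem, rfl⟩
      symm := fun ⟨m, hm, n, hn, h⟩ ↦ ⟨n, hn, m, hm, h.symm⟩
      trans := fun {a b c} ⟨m, hm, n, hn, h⟩ ⟨m', hm', n', hn', h'⟩ ↦
        ⟨m + m', N.add_mem hm hm', n + n', N.add_mem hn hn', by
          rw [← add_assoc, h, add_right_comm, h', add_right_comm, ← add_assoc]⟩ }
  add' := fun {a b c d} ⟨m, hm, n, hn, h⟩ ⟨m', hm', n', hn', h'⟩ ↦
    ⟨m + m', N.add_mem hm hm', n + n', N.add_mem hn hn', by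
      rw [add_add_add_comm, h, h', add_add_add_comm]⟩

/-- Quotienting a commutative monoid by a cofinal submonoid gives a group, in which the elements
that vanish are those that the submonoid contains stably. -/
lemma exists_addCommGroup_of_cofinal {M : Type u} [AddCommMonoid M] (N : AddSubmonoid M)
    (hN : ∀ a : M, ∃ b, a + b ∈ N) :
    ∃ (K : Type u) (_ : AddCommGroup K) (f : M →+ K), ∀ a, f a = 0 ↔ ∃ n ∈ N, a + n ∈ N := by
  have hz (a : M) : (a : (stableCon N).Quotient) = 0 ↔ ∃ n ∈ N, a + n ∈ N := by
    change (a : (stableCon N).Quotient) = ((0 : M) : (stableCon N).Quotient) ↔ _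
    rw [AddCon.eq]
    constructor
    · rintro ⟨m, hm, n, hn, h⟩
      exact ⟨m, hm, by rwa [h, zero_add]⟩
    · rintro ⟨n, hn, h⟩
      exact ⟨n, hn, a + n, h, by rw [zero_add]⟩
  have hneg (x : (stableCon N).Quotient) : ∃ y, y + x = 0 := by
    induction x using AddCon.induction_on with
    | H a =>
      obtain ⟨b, hb⟩ := hN a
      refine ⟨(b : (stableCon N).Quotient), ?_⟩
      rw [← AddCon.coe_add, hz]
      exact ⟨0, N.zero_mem, by rwa [add_zero, add_comm]⟩
  choose neg hneg using hneg
  let _ : Neg (stableCon N).Quotient := ⟨neg⟩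
  let _ : AddCommGroup (stableCon N).Quotient :=
    { (inferInstance : AddCommMonoid (stableCon N).Quotient) with
      neg_add_cancel := hneg
      zsmul := zsmulRec }
  exact ⟨(stableCon N).Quotient, inferInstance, (stableCon N).mk', hz⟩

variable {C : Type u} [Category.{v} C] [HasZeroMorphisms C] [HasBinaryBiproducts C]
  [HasZeroObject C]

open scoped ZeroObject in
/-- The commutative monoid of isomorphism classes of objects under direct sum. -/
@[reducible]
def isoClassesAddCommMonoid (C : Type u) [Category.{v} C] [HasZeroMorphisms C]
    [HasBinaryBiproducts C] [HasZeroObject C] :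
    AddCommMonoid (Quotient (isIsomorphicSetoid C)) :=
  letI : Zero (Quotient (isIsomorphicSetoid C)) := ⟨⟦(0 : C)⟧⟩
  letI : Add (Quotient (isIsomorphicSetoid C)) :=
    ⟨Quotient.map₂ (fun X Y ↦ X ⊞ Y) (fun _ _ ⟨e⟩ _ _ ⟨e'⟩ ↦ ⟨biprod.mapIso e e'⟩)⟩
  { add_assoc := by
      rintro ⟨X⟩ ⟨Y⟩ ⟨Z⟩
      exact Quotient.sound ⟨biprod.associator X Y Z⟩
    zero_add := by
      rintro ⟨X⟩
      exact Quotient.sound ⟨(isoZeroBiprod (isZero_zero C)).symm⟩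
    add_zero := by
      rintro ⟨X⟩
      exact Quotient.sound ⟨(isoBiprodZero (isZero_zero C)).symm⟩
    add_comm := by
      rintro ⟨X⟩ ⟨Y⟩
      exact Quotient.sound ⟨biprod.braiding X Y⟩
    nsmul := nsmulRec }

omit [HasZeroObject C] in
lemma IsAdditiveSubcat.biprod {P : ObjectProperty C} (hP : IsAdditiveSubcat P) {X Y : C}
    (hX : P X) (hY : P Y) : P (X ⊞ Y) :=
  hP.sum (BinaryBiproduct.bicone X Y) ⟨BinaryBiproduct.isBilimit X Y⟩ hX hY

omit [HasZeroObject C] in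
/-- Density, in terms of the chosen biproducts. -/
lemma isDenseSubcat_iff {P : ObjectProperty C} (hP : P.IsClosedUnderIsomorphisms) :
    IsDenseSubcat P ↔ ∀ X : C, ∃ X', P (X ⊞ X') := by
  refine forall_congr' fun X ↦ exists_congr fun X' ↦ ⟨?_, fun h ↦
    ⟨BinaryBiproduct.bicone X X', ⟨BinaryBiproduct.isBilimit X X'⟩, h⟩⟩
  rintro ⟨b, ⟨hb⟩, h⟩
  exact P.prop_of_iso (biprod.uniqueUpToIso _ _ hb) h

/-- A dense additive subcategory `P` has a stable class group: an additive invariant of the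
objects which vanishes exactly on the objects that lie in `P` after adding an object of `P`. -/
lemma exists_stable_class {P : ObjectProperty C} (hP : IsAdditiveSubcat P)
    (hd : IsDenseSubcat P) :
    ∃ (K : Type u) (_ : AddCommGroup K) (f : C → K),
      (∀ ⦃X Y : C⦄, (X ≅ Y) → f X = f Y) ∧ (∀ X Y, f (X ⊞ Y) = f X + f Y) ∧
      ∀ X, f X = 0 ↔ ∃ A, P A ∧ P (X ⊞ A) := by
  have := hP.iso_closed
  let _ := isoClassesAddCommMonoid C
  let q (X : C) : Quotient (isIsomorphicSetoid C) := ⟦X⟧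
  have hq {X Y : C} (h : q X = q Y) (hX : P X) : P Y := by
    obtain ⟨e⟩ := Quotient.exact h
    exact P.prop_of_iso e hX
  let N : AddSubmonoid (Quotient (isIsomorphicSetoid C)) :=
    { carrier := {x | ∃ A, P A ∧ q A = x}
      zero_mem' := by
        obtain ⟨Z, hZ, hPZ⟩ := hP.zero.exists_zero
        exact ⟨Z, hPZ, Quotient.sound ⟨hZ.iso (isZero_zero C)⟩⟩
      add_mem' := by
        rintro _ _ ⟨A, hA, rfl⟩ ⟨B, hB, rfl⟩
        exact ⟨A ⊞ B, hP.biprod hA hB, rfl⟩ }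
  obtain ⟨K, _, f, hf⟩ := exists_addCommGroup_of_cofinal N (by
    rintro ⟨X⟩
    obtain ⟨X', h⟩ := (isDenseSubcat_iff hP.iso_closed).1 hd X
    exact ⟨q X', X ⊞ X', h, rfl⟩)
  refine ⟨K, inferInstance, fun X ↦ f (q X), fun X Y e ↦ congrArg f (Quotient.sound ⟨e⟩),
    fun X Y ↦ f.map_add (q X) (q Y), fun X ↦ (hf _).trans ⟨?_, ?_⟩⟩
  · rintro ⟨_, ⟨A, hA, rfl⟩, ⟨B, hB, h⟩⟩
    exact ⟨A, hA, hq h hB⟩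
  · rintro ⟨A, hA, h⟩
    exact ⟨q A, ⟨A, hA, rfl⟩, ⟨X ⊞ A, h, rfl⟩⟩

omit [HasZeroObject C] in
/-- If `f` is additive on direct sums and vanishes on a dense subcategory `P`, it is additive on
any "extension" `Y` of `Z` by `X` for which complements of `X` and `Z` in `P` give a complement of
`Y` in `P`. -/
lemma additive_of_complement {P : ObjectProperty C} (hPiso : P.IsClosedUnderIsomorphisms)
    (hd : IsDenseSubcat P) {K : Type*} [AddCommGroup K] {f : C → K}
    (hf : ∀ X Y, f (X ⊞ Y) = f X + f Y) (hfP : ∀ X, P X → f X = 0) {X Y Z : C}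
    (h : ∀ X' Z', P (X ⊞ X') → P (Z ⊞ Z') → P (Y ⊞ (X' ⊞ Z'))) : f X - f Y + f Z = 0 := by
  obtain ⟨X', hX⟩ := (isDenseSubcat_iff hPiso).1 hd X
  obtain ⟨Z', hZ⟩ := (isDenseSubcat_iff hPiso).1 hd Z
  have hY := hfP _ (h X' Z' hX hZ)
  have hX := hfP _ hX
  have hZ := hfP _ hZ
  rw [hf] at hX hZ
  rw [hf, hf] at hY
  have : f X - f Y + f Z = (f X + f X') + (f Z + f Z') - (f Y + (f X' + f Z')) := by abel
  rw [this, hX, hY, hZ]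
  simp

end Stable

section SumsOfExtensions

/-- Direct sums of short exact sequences are short exact. -/
lemma shortExact_biprod {C : Type u} [Category.{v} C] [Abelian C] {S S' : ShortComplex C}
    (hS : S.ShortExact) (hS' : S'.ShortExact) :
    (ShortComplex.mk (biprod.map S.f S'.f) (biprod.map S.g S'.g)
      (by ext <;> simp)).ShortExact := by
  have := hS.mono_f
  have := hS.epi_g
  have := hS'.mono_f
  have := hS'.epi_g
  refine { exact := ?_, mono_f := biprod.map_mono _ _, epi_g := biprod.map_epi _ _ }
  rw [ShortComplex.exact_iff_exact_up_to_refinements]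
  intro A x hx
  have h₁ : (x ≫ biprod.fst) ≫ S.g = 0 := by simpa using hx =≫ biprod.fst
  have h₂ : (x ≫ biprod.snd) ≫ S'.g = 0 := by simpa using hx =≫ biprod.snd
  refine ⟨A, 𝟙 A, inferInstance, biprod.lift (hS.exact.lift _ h₁) (hS'.exact.lift _ h₂), ?_⟩
  ext <;> simp

variable {T : Type u} [Category.{v} T] [Preadditive T] [HasZeroObject T] [HasShift T ℤ]
  [∀ n : ℤ, (shiftFunctor T n).Additive] [Pretriangulated T]

/-- Direct sums of distinguished triangles are distinguished. -/
lemma exists_distTriang_biprod (D D' : Triangle T) (hD : D ∈ distTriang T)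
    (hD' : D' ∈ distTriang T) :
    ∃ E ∈ distTriang T, Nonempty (E.obj₁ ≅ D.obj₁ ⊞ D'.obj₁) ∧
      Nonempty (E.obj₂ ≅ D.obj₂ ⊞ D'.obj₂) ∧ Nonempty (E.obj₃ ≅ D.obj₃ ⊞ D'.obj₃) := by
  let F : WalkingPair → Triangle T := fun j ↦ WalkingPair.casesOn j D D'
  have e (X : WalkingPair → T) : Nonempty (∏ᶜ X ≅ X .left ⊞ X .right) :=
    ⟨HasLimit.isoOfNatIso (diagramIsoPair (Discrete.functor X)) ≪≫ (biprod.isoProd _ _).symm⟩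
  exact ⟨productTriangle F, productTriangle_distinguished F (by rintro (_ | _) <;> assumption),
    e fun j ↦ (F j).obj₁, e fun j ↦ (F j).obj₂, e fun j ↦ (F j).obj₃⟩

end SumsOfExtensions

/-! ### Dense subcategories and subgroups -/

section Membership

/-- An object of an abelian category belongs to a dense, extension-closed and stably closed
subcategory `P` as soon as its class is generated by the classes of objects of `P`. -/
lemma prop_of_clsExact_mem {C : Type u} [Category.{v} C] [Abelian C] {P : ObjectProperty C}
    (hP : IsAdditiveSubcat P) (hd : IsDenseSubcat P)
    (hext : ∀ S : ShortComplex C, S.ShortExact → P S.X₁ → P S.X₃ → P S.X₂)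
    (hcancel : ∀ X A, P A → P (X ⊞ A) → P X) {X : C}
    (hX : clsExact X ∈ AddSubgroup.closure {x | ∃ A, P A ∧ x = clsExact A}) : P X := by
  obtain ⟨K, _, f, hiso, hadd, hf⟩ := exists_stable_class hP hd
  have hfP (A : C) (hA : P A) : f A = 0 := (hf A).2 ⟨A, hA, hP.biprod hA hA⟩
  obtain ⟨θ, hθ⟩ := exists_lift_clsExact f hiso (fun S hS ↦
    additive_of_complement hP.iso_closed hd hadd hfP fun X' Z' hX' hZ' ↦
      hext _ (shortExact_biprod hS (ShortComplex.Splitting.ofHasBinaryBiproduct X' Z').shortExact)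
        hX' hZ')
  have hle : AddSubgroup.closure {x | ∃ A, P A ∧ x = clsExact A} ≤ θ.ker := by
    rw [AddSubgroup.closure_le]
    rintro _ ⟨A, hA, rfl⟩
    exact (hθ A).trans (hfP A hA)
  obtain ⟨A, hA, hXA⟩ := (hf X).1 ((hθ X).symm.trans (hle hX))
  exact hcancel X A hA hXA

variable {T : Type u} [Category.{v} T] [Preadditive T] [HasZeroObject T] [HasShift T ℤ]
  [∀ n : ℤ, (shiftFunctor T n).Additive] [Pretriangulated T]

lemma isAdditiveSubcat_of_isTriangulated (Q : ObjectProperty T) [Q.IsTriangulated]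
    [Q.IsClosedUnderIsomorphisms] : IsAdditiveSubcat Q where
  iso_closed := inferInstance
  zero := inferInstance
  sum := fun A B _ ⟨hb⟩ hA hB ↦ Q.prop_of_iso (biprod.uniqueUpToIso _ _ hb).symm
    (Q.ext_of_isTriangulatedClosed₂ _ (binaryBiproductTriangle_distinguished A B) hA hB)

/-- An object of `T` belongs to a dense triangulated subcategory as soon as its class is generated
by the classes of objects of the subcategory (Thomason). -/
lemma prop_of_clsTri_mem {Q : ObjectProperty T} [Q.IsTriangulated]
    [Q.IsClosedUnderIsomorphisms] (hd : IsDenseSubcat Q) {X : T}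
    (hX : clsTri X ∈ triToSubgroup Q) : Q X := by
  have hQ := isAdditiveSubcat_of_isTriangulated Q
  obtain ⟨K, _, f, hiso, hadd, hf⟩ := exists_stable_class hQ hd
  have hfQ (A : T) (hA : Q A) : f A = 0 := (hf A).2 ⟨A, hA, hQ.biprod hA hA⟩
  obtain ⟨θ, hθ⟩ := exists_lift_clsTri f hiso (fun D hD ↦
    additive_of_complement hQ.iso_closed hd hadd hfQ fun X' Z' hX' hZ' ↦ by
      obtain ⟨E, hE, ⟨e₁⟩, ⟨e₂⟩, ⟨e₃⟩⟩ := exists_distTriang_biprod D _ hD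
        (binaryBiproductTriangle_distinguished X' Z')
      exact Q.prop_of_iso e₂ (Q.ext_of_isTriangulatedClosed₂ E hE (Q.prop_of_iso e₁.symm hX')
        (Q.prop_of_iso e₃.symm hZ')))
  have hle : triToSubgroup Q ≤ θ.ker := by
    rw [triToSubgroup, AddSubgroup.closure_le]
    rintro _ ⟨A, hA, rfl⟩
    exact (hθ A).trans (hfQ A hA)
  obtain ⟨A, hA, hXA⟩ := (hf X).1 ((hθ X).symm.trans (hle hX))
  exact Q.ext_of_isTriangulatedClosed₁ _ (binaryBiproductTriangle_distinguished X A) hXA hA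

end Membership

section Triangulated

variable {T : Type u} [Category.{v} T] [Preadditive T] [HasZeroObject T] [HasShift T ℤ]
  [∀ n : ℤ, (shiftFunctor T n).Additive] [Pretriangulated T]

lemma exists_clsTri_eq (x : KZeroTri T) : ∃ X : T, clsTri X = x := by
  have hx : x ∈ AddSubgroup.closure (Set.range (clsTri (T := T))) := by
    rw [closure_range_clsTri]; trivial
  induction hx using AddSubgroup.closure_induction with
  | mem x hx => exact hx
  | zero => exact ⟨_, clsTri_of_isZero (isZero_zero T)⟩
  | add x y _ _ hx hy =>
    obtain ⟨X, rfl⟩ := hx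
    obtain ⟨Y, rfl⟩ := hy
    exact ⟨X ⊞ Y, clsTri_biprod X Y⟩
  | neg x _ hx =>
    obtain ⟨X, rfl⟩ := hx
    exact ⟨X⟦(1 : ℤ)⟧, clsTri_shift_one X⟩

instance subgroupToTri_isClosedUnderIsomorphisms (H : AddSubgroup (KZeroTri T)) :
    (subgroupToTri H).IsClosedUnderIsomorphisms where
  of_iso e hX := by rwa [subgroupToTri, ← clsTri_eq_of_iso e]

instance subgroupToTri_isTriangulated (H : AddSubgroup (KZeroTri T)) :
    (subgroupToTri H).IsTriangulated where
  exists_zero := ⟨_, isZero_zero T, by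
    rw [subgroupToTri, clsTri_of_isZero (isZero_zero T)]; exact zero_mem H⟩
  isStableUnderShiftBy n := ⟨fun X hX ↦ by
    change clsTri (X⟦n⟧) ∈ H
    rw [clsTri_shift]
    exact H.zsmul_mem hX _⟩
  toIsTriangulatedClosed₂ := .mk' fun D hD h₁ h₃ ↦ by
    rw [subgroupToTri, clsTri_of_distTriang D hD]
    exact add_mem h₁ h₃

lemma subgroupToTri_isDenseSubcat (H : AddSubgroup (KZeroTri T)) :
    IsDenseSubcat (subgroupToTri H) := by
  rw [isDenseSubcat_iff inferInstance]
  intro X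
  refine ⟨X⟦(1 : ℤ)⟧, ?_⟩
  rw [subgroupToTri, clsTri_biprod, clsTri_shift_one, add_neg_cancel]
  exact zero_mem H

variable {t : TStructure T} (G : ObjectProperty (HeartCat t))

lemma mapsTo_triToSubgroup :
    Set.MapsTo triToSubgroup (denseTriangulated G) (subgroupsContaining G) :=
  fun _ hQ A hA ↦ AddSubgroup.subset_closure ⟨A.obj, hQ.2.2.2 A hA, rfl⟩

lemma mapsTo_subgroupToTri :
    Set.MapsTo subgroupToTri (subgroupsContaining G) (denseTriangulated G) :=
  fun H hH ↦ ⟨inferInstance, inferInstance, subgroupToTri_isDenseSubcat H, hH⟩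

lemma invOn_subgroupToTri :
    Set.InvOn subgroupToTri triToSubgroup (denseTriangulated G) (subgroupsContaining G) := by
  refine ⟨fun Q ⟨_, _, hd, _⟩ ↦ ?_, fun H _ ↦ le_antisymm ?_ fun h hh ↦ ?_⟩
  · ext X
    exact ⟨prop_of_clsTri_mem hd, fun hX ↦ AddSubgroup.subset_closure ⟨X, hX, rfl⟩⟩
  · rw [triToSubgroup, AddSubgroup.closure_le]
    rintro _ ⟨X, hX, rfl⟩
    exact hX
  · obtain ⟨X, rfl⟩ := exists_clsTri_eq h
    exact AddSubgroup.subset_closure ⟨X, hh, rfl⟩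

end Triangulated

section HeartSubcategories

variable {T : Type u} [Category.{v} T] [Preadditive T] [HasZeroObject T] [HasShift T ℤ]
  [∀ n : ℤ, (shiftFunctor T n).Additive] [Pretriangulated T] [IsTriangulated T]
  {t : TStructure T}

omit [IsTriangulated T] in
lemma clsTri_heart_eq_of_iso {A B : HeartCat t} (e : A ≅ B) : clsTri A.obj = clsTri B.obj :=
  clsTri_eq_of_iso (t.heart.ι.mapIso e)

omit [IsTriangulated T] in
lemma clsTri_heart_of_isZero {A : HeartCat t} (hA : IsZero A) : clsTri A.obj = 0 :=
  clsTri_of_isZero (t.heart.ι.map_isZero hA)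

lemma clsTri_heart_biprod (A B : HeartCat t) :
    clsTri (A ⊞ B).obj = clsTri A.obj + clsTri B.obj :=
  clsTri_of_shortExact (ShortComplex.Splitting.ofHasBinaryBiproduct A B).shortExact

lemma subgroupToHeart_isAdditiveSubcat (H : AddSubgroup (KZeroTri T)) :
    IsAdditiveSubcat (subgroupToHeart t H) where
  iso_closed := ⟨fun e hX ↦ by
    rwa [subgroupToHeart, ← clsTri_heart_eq_of_iso e]⟩
  zero := ⟨_, isZero_zero _, by
    rw [subgroupToHeart, clsTri_heart_of_isZero (isZero_zero _)]
    exact zero_mem H⟩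
  sum := fun A B b ⟨hb⟩ hA hB ↦ by
    rw [subgroupToHeart, clsTri_heart_eq_of_iso (biprod.uniqueUpToIso _ _ hb),
      clsTri_heart_biprod]
    exact add_mem hA hB

variable {G : ObjectProperty (HeartCat t)}

/-- Whether `G` is a generator or a cogenerator, each class of the heart has a complement with
respect to the class of an object of `G`; this is all that the correspondences use. -/
lemma exists_complement_class (hG : IsGeneratorFamily G ∨ IsCogeneratorFamily G)
    (A : HeartCat t) :
    ∃ A' N : HeartCat t, G N ∧ clsTri N.obj = clsTri A.obj + clsTri A'.obj := by
  rcases hG with hG | hG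
  · obtain ⟨A', N, i, p, h, hS, hN⟩ := hG A
    exact ⟨A', N, hN, (clsTri_of_shortExact hS).trans (add_comm _ _)⟩
  · obtain ⟨N, A', i, p, h, hS, hN⟩ := hG A
    exact ⟨A', N, hN, clsTri_of_shortExact hS⟩

lemma subgroupToHeart_isDenseSubcat (hG : IsGeneratorFamily G ∨ IsCogeneratorFamily G)
    {H : AddSubgroup (KZeroTri T)} (hH : H ∈ subgroupsContaining G) :
    IsDenseSubcat (subgroupToHeart t H) := by
  rw [isDenseSubcat_iff (subgroupToHeart_isAdditiveSubcat H).iso_closed]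
  intro A
  obtain ⟨A', N, hN, h⟩ := exists_complement_class hG A
  refine ⟨A', ?_⟩
  rw [subgroupToHeart, clsTri_heart_biprod, ← h]
  exact hH N hN

lemma mapsTo_subgroupToHeart (hG : IsGeneratorFamily G ∨ IsCogeneratorFamily G) :
    Set.MapsTo (subgroupToHeart t) (subgroupsContaining G) (denseResolving G) := by
  intro H hH
  refine ⟨⟨subgroupToHeart_isAdditiveSubcat H, fun S hS h₁ h₃ ↦ ?_, fun S hS h₂ h₃ ↦ ?_, hH⟩,
    subgroupToHeart_isDenseSubcat hG hH⟩
  · rw [subgroupToHeart, clsTri_of_shortExact hS]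
    exact add_mem h₁ h₃
  · rw [subgroupToHeart, clsTri_of_shortExact hS] at h₂
    exact (add_mem_cancel_right h₃).1 h₂

lemma mapsTo_subgroupToHeart_coresolving (hG : IsGeneratorFamily G ∨ IsCogeneratorFamily G) :
    Set.MapsTo (subgroupToHeart t) (subgroupsContaining G) (denseCoresolving G) := by
  intro H hH
  refine ⟨⟨subgroupToHeart_isAdditiveSubcat H, fun S hS h₁ h₃ ↦ ?_, fun S hS h₁ h₂ ↦ ?_, hH⟩,
    subgroupToHeart_isDenseSubcat hG hH⟩
  · rw [subgroupToHeart, clsTri_of_shortExact hS]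
    exact add_mem h₁ h₃
  · rw [subgroupToHeart, clsTri_of_shortExact hS] at h₂
    exact (add_mem_cancel_left h₁).1 h₂

omit [IsTriangulated T] in
lemma heartToSubgroup_mem_subgroupsContaining {P : ObjectProperty (HeartCat t)} (hP : G ≤ P) :
    heartToSubgroup P ∈ subgroupsContaining G :=
  fun A hA ↦ AddSubgroup.subset_closure ⟨A, hP A hA, rfl⟩

/-- The heart version of `prop_of_clsTri_mem`: through the isomorphism of Grothendieck groups the
question is moved to the Grothendieck group of the heart. -/
lemma subgroupToHeart_heartToSubgroup (ht : ∀ X : T, t.bounded X)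
    {P : ObjectProperty (HeartCat t)} (hP : IsAdditiveSubcat P) (hd : IsDenseSubcat P)
    (hext : ∀ S : ShortComplex (HeartCat t), S.ShortExact → P S.X₁ → P S.X₃ → P S.X₂)
    (hcancel : ∀ X A, P A → P (X ⊞ A) → P X) :
    subgroupToHeart t (heartToSubgroup P) = P := by
  obtain ⟨φ, hφ⟩ := exists_addEquiv_KZero ht
  ext X
  refine ⟨fun hX ↦ prop_of_clsExact_mem hP hd hext hcancel ?_,
    fun hX ↦ AddSubgroup.subset_closure ⟨X, hX, rfl⟩⟩
  have hle : heartToSubgroup P ≤ (AddSubgroup.closure {x | ∃ A, P A ∧ x = clsExact A}).map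
      φ.toAddMonoidHom := by
    rw [heartToSubgroup, AddSubgroup.closure_le]
    rintro _ ⟨A, hA, rfl⟩
    exact ⟨clsExact A, AddSubgroup.subset_closure ⟨A, hA, rfl⟩, hφ A⟩
  obtain ⟨x, hx, h⟩ := hle hX
  rwa [← φ.injective (h.trans (hφ X).symm)]

lemma IsResolving.cancel {P : ObjectProperty (HeartCat t)} (hP : IsResolving G P)
    (X A : HeartCat t) (hA : P A) (hXA : P (X ⊞ A)) : P X :=
  hP.ker_closed _ (ShortComplex.Splitting.ofHasBinaryBiproduct X A).shortExact hXA hA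

lemma IsCoresolving.cancel {P : ObjectProperty (HeartCat t)} (hP : IsCoresolving G P)
    (X A : HeartCat t) (hA : P A) (hXA : P (X ⊞ A)) : P X := by
  have := hP.additive.iso_closed
  exact hP.coker_closed _ (ShortComplex.Splitting.ofHasBinaryBiproduct A X).shortExact hA
    (P.prop_of_iso (biprod.braiding X A) hXA)

lemma denseResolving_eq_denseCoresolving (ht : ∀ X : T, t.bounded X)
    (hG : IsGeneratorFamily G ∨ IsCogeneratorFamily G) :
    denseResolving G = denseCoresolving G := by
  ext P
  constructor
  · rintro ⟨hP, hd⟩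
    rw [← subgroupToHeart_heartToSubgroup ht hP.additive hd hP.ext_closed hP.cancel]
    exact mapsTo_subgroupToHeart_coresolving hG
      (heartToSubgroup_mem_subgroupsContaining hP.contains)
  · rintro ⟨hP, hd⟩
    rw [← subgroupToHeart_heartToSubgroup ht hP.additive hd hP.ext_closed hP.cancel]
    exact mapsTo_subgroupToHeart hG (heartToSubgroup_mem_subgroupsContaining hP.contains)

open scoped ZeroObject in
lemma exists_clsTri_sub_eq (ht : ∀ X : T, t.bounded X) (x : KZeroTri T) :
    ∃ A B : HeartCat t, x = clsTri A.obj - clsTri B.obj := by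
  have h0 : clsTri (0 : HeartCat t).obj = 0 :=
    clsTri_heart_of_isZero (isZero_zero _)
  let H : AddSubgroup (KZeroTri T) :=
    { carrier := {x | ∃ A B : HeartCat t, x = clsTri A.obj - clsTri B.obj}
      zero_mem' := ⟨0, 0, (sub_self _).symm⟩
      add_mem' := by
        rintro _ _ ⟨A, B, rfl⟩ ⟨A', B', rfl⟩
        exact ⟨A ⊞ A', B ⊞ B', by rw [clsTri_heart_biprod, clsTri_heart_biprod]; abel⟩
      neg_mem' := by
        rintro _ ⟨A, B, rfl⟩
        exact ⟨B, A, neg_sub _ _⟩ }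
  obtain ⟨X, rfl⟩ := exists_clsTri_eq x
  exact clsTri_mem_of_heart ht H (fun A ↦ ⟨A, 0, by rw [h0, sub_zero]⟩) X

lemma invOn_subgroupToHeart (ht : ∀ X : T, t.bounded X)
    (hG : IsGeneratorFamily G ∨ IsCogeneratorFamily G) :
    Set.InvOn (subgroupToHeart t) heartToSubgroup (denseResolving G) (subgroupsContaining G) := by
  refine ⟨fun P ⟨hP, hd⟩ ↦
    subgroupToHeart_heartToSubgroup ht hP.additive hd hP.ext_closed hP.cancel,
    fun H hH ↦ le_antisymm ?_ fun h hh ↦ ?_⟩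
  · rw [heartToSubgroup, AddSubgroup.closure_le]
    rintro _ ⟨A, hA, rfl⟩
    exact hA
  · -- Write `h = [A] - [B]` and choose `B'` with `[B] + [B'] = [N]`, `N` in `G`: then
    -- `h = [A ⊞ B'] - [N]`, where both classes lie in `H`.
    obtain ⟨A, B, rfl⟩ := exists_clsTri_sub_eq ht h
    obtain ⟨B', N, hN, hBN⟩ := exists_complement_class hG B
    have e : clsTri A.obj - clsTri B.obj = clsTri (A ⊞ B').obj - clsTri N.obj := by
      rw [hBN, clsTri_heart_biprod]; abel
    have hN' : clsTri N.obj ∈ H := hH N hN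
    rw [e] at hh ⊢
    have hAB : clsTri (A ⊞ B').obj ∈ H := by simpa using add_mem hh hN'
    exact sub_mem (AddSubgroup.subset_closure ⟨_, hAB, rfl⟩)
      (AddSubgroup.subset_closure ⟨_, hN', rfl⟩)

end HeartSubcategories

end

end DenseSubcat

theorem mainTheorem6 {T : Type u} [Category.{v} T] [Preadditive T] [HasZeroObject T]
    [HasShift T ℤ] [∀ n : ℤ, (shiftFunctor T n).Additive] [Pretriangulated T]
    [IsTriangulated T] [EssentiallySmall.{w} T]
    (t : TStructure T) (ht : ∀ X : T, t.bounded X)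
    (G : ObjectProperty (DenseSubcat.HeartCat t))
    (hG : DenseSubcat.IsGeneratorFamily G ∨ DenseSubcat.IsCogeneratorFamily G) :
    -- the inclusion of the heart induces an isomorphism of Grothendieck groups
    (∃ φ : DenseSubcat.KZeroExact (DenseSubcat.HeartCat t) ≃+ DenseSubcat.KZeroTri T,
      ∀ A : DenseSubcat.HeartCat t, φ (DenseSubcat.clsExact A) = DenseSubcat.clsTri A.obj) ∧
    -- dense resolving and dense coresolving subcategories of the heart coincide
    DenseSubcat.denseResolving G = DenseSubcat.denseCoresolving G ∧
    -- subcategories of the heart and subgroups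
    (Set.MapsTo DenseSubcat.heartToSubgroup
        (DenseSubcat.denseResolving G) (DenseSubcat.subgroupsContaining G) ∧
      Set.MapsTo (DenseSubcat.subgroupToHeart t)
        (DenseSubcat.subgroupsContaining G) (DenseSubcat.denseResolving G) ∧
      Set.InvOn (DenseSubcat.subgroupToHeart t) DenseSubcat.heartToSubgroup
        (DenseSubcat.denseResolving G) (DenseSubcat.subgroupsContaining G)) ∧
    -- triangulated subcategories and subgroups
    (Set.MapsTo DenseSubcat.triToSubgroup
        (DenseSubcat.denseTriangulated G) (DenseSubcat.subgroupsContaining G) ∧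
      Set.MapsTo DenseSubcat.subgroupToTri
        (DenseSubcat.subgroupsContaining G) (DenseSubcat.denseTriangulated G) ∧
      Set.InvOn DenseSubcat.subgroupToTri DenseSubcat.triToSubgroup
        (DenseSubcat.denseTriangulated G) (DenseSubcat.subgroupsContaining G)) ∧
    -- triangulated subcategories and subcategories of the heart, by intersection
    Set.BijOn (fun Q : ObjectProperty T => Q.inverseImage t.heart.ι)
      (DenseSubcat.denseTriangulated G) (DenseSubcat.denseResolving G) := by
  have hheart := DenseSubcat.mapsTo_subgroupToHeart (t := t) hG
  have hheart' : Set.MapsTo DenseSubcat.heartToSubgroup (DenseSubcat.denseResolving G)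
      (DenseSubcat.subgroupsContaining G) :=
    fun _ hP ↦ DenseSubcat.heartToSubgroup_mem_subgroupsContaining hP.1.contains
  have hinv := DenseSubcat.invOn_subgroupToHeart ht hG
  refine ⟨DenseSubcat.exists_addEquiv_KZero ht,
    DenseSubcat.denseResolving_eq_denseCoresolving ht hG, ⟨hheart', hheart, hinv⟩,
    ⟨DenseSubcat.mapsTo_triToSubgroup G, DenseSubcat.mapsTo_subgroupToTri G,
      DenseSubcat.invOn_subgroupToTri G⟩, ?_⟩
  -- A dense triangulated `Q` consists of the objects with class in `triToSubgroup Q`, so `Q ∩ A`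
  -- is the composite of the two bijections through the subgroups.
  refine ((hinv.symm.bijOn hheart hheart').comp ((DenseSubcat.invOn_subgroupToTri G).bijOn
    (DenseSubcat.mapsTo_triToSubgroup G) (DenseSubcat.mapsTo_subgroupToTri G))).congr ?_
  intro Q hQ
  exact congrArg (fun Q : ObjectProperty T ↦ Q.inverseImage t.heart.ι)
    ((DenseSubcat.invOn_subgroupToTri G).1 hQ)
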